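/- Let $V$ be a finite set and let $G, G'$ be directed acyclic graphs with vertex set $V$. Write $\mathrm{pa}_G(v)=\{u : u\to v \text{ in } G\}$ for the set of parents of $v$; a set $A\subseteq V$ is ancestral in $G$ if $\mathrm{pa}_G(v)\subseteq A$ for all $v\in A$, and $\mathrm{an}_G(B)$ denotes the smallest ancestral set containing $B$. The moral graph of a directed graph is the undirected graph obtained by joining any two distinct vertices that have a common child and then forgetting the directions of the edges. The semi-graphoid of $G$ is the set $\mathcal M(G)$ of all triples $\langle A,B\mid C\rangle$ of (not necessarily disjoint) subsets of $V$ such that $A$ and $B$ are separated by $C$ in the moral graph of the subgraph of $G$ induced on $\mathrm{an}_G(A\cup B\cup C)$, that is, such that every path in that moral graph (including paths of length zero) from an element of $A$ to an element of $B$ contains an element of $C$. The graphs $G$ and $G'$ are Markov equivalent if $\mathcal M(G)=\mathcal M(G')$. The d-clique vector of $G$ is $$t(G)=\sum_{v\in V}\bigl[\delta(\{v\}\cup \mathrm{pa}_G(v))-\delta(\mathrm{pa}_G(v))\bigr]+\delta(\varnothing)\in\mathbb Z^{2^V},\qquad \delta(A)=(\mathbf 1_{S=A})_{S\subseteq V}.$$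 Then $G$ and $G'$ are Markov equivalent if and only if $t(G)=t(G')$. -/

import Mathlib

namespace DagMarkov

universe u

variable {V : Type u}

/-- A directed graph is acyclic if its vertex set has a (strict) well-ordering `r` that is
compatible with it: `r u v` for every edge `u → v`. -/
def IsAcyclic (G : Digraph V) : Prop :=
  ∃ r : V → V → Prop, IsWellOrder V r ∧ ∀ u v, G.Adj u v → r u v

/-- The set of parents of `v`. -/
def parents (G : Digraph V) (v : V) : Set V := {u | G.Adj u v}

/-- The subgraph induced on the vertex set `S`. -/
def induced (G : Digraph V) (S : Set V) : Digraph S where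
  Adj u v := G.Adj u v

/-- A set of vertices is ancestral if it contains the parents of each of its elements. -/
def IsAncestral (G : Digraph V) (A : Set V) : Prop :=
  ∀ v ∈ A, parents G v ⊆ A

/-- The smallest ancestral set that contains `B`. -/
def ancestralClosure (G : Digraph V) (B : Set V) : Set V :=
  ⋂₀ {A | IsAncestral G A ∧ B ⊆ A}

/-- The moral graph: the skeleton, with an edge added between any two distinct vertices that have
a common child. -/
def moralGraph (G : Digraph V) : SimpleGraph V :=
  SimpleGraph.fromRel fun u v => G.Adj u v ∨ ∃ w, G.Adj u w ∧ G.Adj v w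

/-- `A` and `B` are separated by `C` in the undirected graph `H` if every path (any walk, possibly
of length zero) from an element of `A` to an element of `B` contains an element of `C`. -/
def Separated (H : SimpleGraph V) (A B C : Set V) : Prop :=
  ∀ a ∈ A, ∀ b ∈ B, ∀ p : H.Walk a b, ∃ c ∈ p.support, c ∈ C

/-- The semi-graphoid of a directed acyclic graph: the triples `(A, B, C)`, standing for
`⟨A, B | C⟩`, such that `A` and `B` are separated by `C` in the moral graph of the subgraph induced
on the smallest ancestral set containing `A ∪ B ∪ C`. -/
def semigraphoid (G : Digraph V) : Set (Set V × Set V × Set V) :=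
  {T | Separated (moralGraph (induced G (ancestralClosure G (T.1 ∪ T.2.1 ∪ T.2.2))))
    (Subtype.val ⁻¹' T.1) (Subtype.val ⁻¹' T.2.1) (Subtype.val ⁻¹' T.2.2)}

/-- Markov equivalence: equality of semi-graphoids. -/
def MarkovEquiv (G G' : Digraph V) : Prop := semigraphoid G = semigraphoid G'

open Classical in
/-- The unit vector of `ℤ^(2^V)` at the coordinate `A`. -/
noncomputable def delta (A : Set V) : Set V → ℤ := fun S => if S = A then 1 else 0

/-- The d-clique vector. -/
noncomputable def dCliqueVector [Fintype V] (G : Digraph V) : Set V → ℤ :=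
  (∑ v : V, (delta ({v} ∪ parents G v) - delta (parents G v))) + delta ∅

end DagMarkov

namespace DagMarkov

universe u

variable {V : Type u}

/-! Both invariants are equivalent to the collection of families. For the d-clique vector, sum
coordinates over supersets: a nonempty `S` gets the number of its vertices whose parents include the
rest of `S`. By acyclicity this is 1 for families and 0 otherwise, and superset sums determine a
vector (`upperSum_injective`). The semi-graphoid detects families (`isFamily_iff_semigraphoid`): no
two members of a family can be separated while conditioning on the rest. Conversely, families
determine moral edges inside any fixed vertex set, so only the ancestral sets of `G` and `G'` can
differ. `Joined.inter` reroutes a path from one into the other, deleting surplus vertices one by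
one; `exists_dominating_child` shows that each can be bypassed. -/

/-- A nonempty set `S` consisting of a vertex `v` and some of its parents. -/
def IsFamily (G : Digraph V) (S : Set V) : Prop :=
  ∃ v ∈ S, ∀ u ∈ S, u ≠ v → G.Adj u v

/-- Adjacency in the moral graph of the subgraph induced on `E`, as a relation on `V`. -/
def MoralAdj (G : Digraph V) (E : Set V) (u v : V) : Prop :=
  u ≠ v ∧ ∃ S, S ⊆ E ∧ u ∈ S ∧ v ∈ S ∧ IsFamily G S

/-- `a` and `b` are joined by a path outside `C` in the moral graph of the subgraph induced
on `E`. -/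
def Joined (G : Digraph V) (E C : Set V) (a b : V) : Prop :=
  a ∉ C ∧ Relation.ReflTransGen (fun x y => MoralAdj G E x y ∧ y ∉ C) a b

theorem IsAcyclic.irrefl {G : Digraph V} (hG : IsAcyclic G) (v : V) : ¬ G.Adj v v := by
  obtain ⟨r, hr, h⟩ := hG
  exact fun hv => irrefl_of r v (h v v hv)

theorem IsAcyclic.asymm {G : Digraph V} (hG : IsAcyclic G) {u v : V} (h : G.Adj u v) :
    ¬ G.Adj v u := by
  obtain ⟨r, hr, hrG⟩ := hG
  exact fun h' => irrefl_of r u (trans_of r (hrG u v h) (hrG v u h'))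

/-- A nonempty subset of a finite type has a last element with respect to a well-order. -/
theorem exists_last {r : V → V → Prop} [Finite V] (hr : IsWellOrder V r) {S : Set V}
    (hS : S.Nonempty) : ∃ v ∈ S, ∀ u ∈ S, ¬ r v u := by
  have hwf : WellFounded (Function.swap r) := by
    have : Std.Irrefl (Function.swap r) := ⟨fun a => irrefl_of r a⟩
    have : IsTrans V (Function.swap r) := ⟨fun a b c hab hbc => trans_of r hbc hab⟩
    exact Finite.wellFounded_of_trans_of_irrefl _
  exact ⟨hwf.min S hS, hwf.min_mem S hS, fun u hu => hwf.not_lt_min S hu⟩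

/-! ### Moral edges and paths in terms of families -/

theorem moralAdj_iff {G : Digraph V} {E : Set V} {u v : V} :
    MoralAdj G E u v ↔ u ≠ v ∧ u ∈ E ∧ v ∈ E ∧
      (G.Adj u v ∨ G.Adj v u ∨ ∃ w ∈ E, G.Adj u w ∧ G.Adj v w) := by
  constructor
  · rintro ⟨hne, S, hSE, hu, hv, w, hw, h⟩
    refine ⟨hne, hSE hu, hSE hv, ?_⟩
    by_cases huw : u = w
    · subst huw
      exact Or.inr (Or.inl (h v hv hne.symm))
    · by_cases hvw : v = w
      · subst hvw
        exact Or.inl (h u hu huw)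
      · exact Or.inr (Or.inr ⟨w, hSE hw, h u hu huw, h v hv hvw⟩)
  · rintro ⟨hne, hu, hv, h | h | ⟨w, hw, huw, hvw⟩⟩
    · refine ⟨hne, {u, v}, by grind, by grind, by grind, v, by grind, by grind⟩
    · refine ⟨hne, {u, v}, by grind, by grind, by grind, u, by grind, by grind⟩
    · refine ⟨hne, {u, v, w}, by grind, by grind, by grind, w, by grind, by grind⟩

theorem MoralAdj.symm {G : Digraph V} {E : Set V} {u v : V} (h : MoralAdj G E u v) :
    MoralAdj G E v u := by
  obtain ⟨hne, S, hSE, hu, hv, hS⟩ := h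
  exact ⟨hne.symm, S, hSE, hv, hu, hS⟩

theorem MoralAdj.mono {G : Digraph V} {E E' : Set V} (hE : E ⊆ E') {u v : V}
    (h : MoralAdj G E u v) : MoralAdj G E' u v := by
  obtain ⟨hne, S, hSE, hS⟩ := h
  exact ⟨hne, S, hSE.trans hE, hS⟩

theorem Joined.mono {G : Digraph V} {E E' C : Set V} (hE : E ⊆ E') {a b : V}
    (h : Joined G E C a b) : Joined G E' C a b :=
  ⟨h.1, Relation.ReflTransGen.mono (fun _ _ hxy => ⟨hxy.1.mono hE, hxy.2⟩) _ _ h.2⟩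

theorem moralAdj_congr {G G' : Digraph V} (h : ∀ S, IsFamily G S ↔ IsFamily G' S) :
    MoralAdj G = MoralAdj G' := by
  funext E u v
  simp only [MoralAdj, h]

theorem joined_congr {G G' : Digraph V} (h : ∀ S, IsFamily G S ↔ IsFamily G' S)
    {E C : Set V} {a b : V} : Joined G E C a b ↔ Joined G' E C a b := by
  simp only [Joined, moralAdj_congr h]

theorem moralGraph_induced_adj {G : Digraph V} {E : Set V} {u v : E} :
    (moralGraph (induced G E)).Adj u v ↔ MoralAdj G E u v := by
  rw [moralAdj_iff]
  simp only [moralGraph, SimpleGraph.fromRel_adj, induced, Subtype.exists, ne_eq,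
    Subtype.ext_iff, Subtype.coe_prop, true_and]
  refine and_congr_right fun _ => ?_
  constructor
  · rintro ((h | ⟨w, hw, h1, h2⟩) | (h | ⟨w, hw, h1, h2⟩))
    · exact Or.inl h
    · exact Or.inr (Or.inr ⟨w, hw, h1, h2⟩)
    · exact Or.inr (Or.inl h)
    · exact Or.inr (Or.inr ⟨w, hw, h2, h1⟩)
  · rintro (h | h | ⟨w, hw, h1, h2⟩)
    · exact Or.inl (Or.inl h)
    · exact Or.inr (Or.inl h)
    · exact Or.inl (Or.inr ⟨w, hw, h1, h2⟩)

theorem joined_of_walk {G : Digraph V} {E C : Set V} {a b : E}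
    (p : (moralGraph (induced G E)).Walk a b) (hp : ∀ c ∈ p.support, (c : V) ∉ C) :
    Joined G E C a b := by
  induction p with
  | nil => exact ⟨hp _ (by simp), .refl⟩
  | @cons u v w h p ih =>
    have ih' := ih fun c hc => hp c (by simp [hc])
    exact ⟨hp _ (by simp), .head ⟨moralGraph_induced_adj.1 h, ih'.1⟩ ih'.2⟩

theorem Joined.exists_walk {G : Digraph V} {E C : Set V} {a b : V} (ha : a ∈ E)
    (h : Joined G E C a b) : ∃ hb : b ∈ E,
      ∃ p : (moralGraph (induced G E)).Walk ⟨a, ha⟩ ⟨b, hb⟩, ∀ c ∈ p.support, (c : V) ∉ C := by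
  obtain ⟨haC, h⟩ := h
  induction h with
  | refl => exact ⟨ha, .nil, by simpa using haC⟩
  | @tail x y _ hxy ih =>
    obtain ⟨hx, p, hp⟩ := ih
    have hy : y ∈ E := (moralAdj_iff.1 hxy.1).2.2.1
    refine ⟨hy, p.concat (moralGraph_induced_adj.2 hxy.1), fun c hc => ?_⟩
    rw [SimpleGraph.Walk.support_concat, List.mem_append,
      List.mem_singleton] at hc
    rcases hc with hc | rfl
    · exact hp c hc
    · exact hxy.2

theorem subset_ancestralClosure (G : Digraph V) (B : Set V) : B ⊆ ancestralClosure G B :=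
  Set.subset_sInter fun _ hA => hA.2

theorem isAncestral_ancestralClosure (G : Digraph V) (B : Set V) :
    IsAncestral G (ancestralClosure G B) :=
  fun _ hv _ hu A hA => hA.1 _ (hv A hA) hu

theorem ancestralClosure_subset {G : Digraph V} {A B : Set V} (hA : IsAncestral G A)
    (hB : B ⊆ A) : ancestralClosure G B ⊆ A :=
  Set.sInter_subset_of_mem ⟨hA, hB⟩

theorem mem_semigraphoid_iff {G : Digraph V} {A B C : Set V} :
    (A, B, C) ∈ semigraphoid G ↔
      ∀ a ∈ A, ∀ b ∈ B, ¬ Joined G (ancestralClosure G (A ∪ B ∪ C)) C a b := by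
  constructor
  · intro h a ha b hb hj
    have haE := subset_ancestralClosure G (A ∪ B ∪ C) (Or.inl (Or.inl ha))
    obtain ⟨hbE, p, hp⟩ := hj.exists_walk haE
    obtain ⟨c, hc, hcC⟩ := h ⟨a, haE⟩ ha ⟨b, hbE⟩ hb p
    exact hp c hc hcC
  · intro h a ha b hb p
    by_contra hp
    push Not at hp
    exact h a ha b hb (joined_of_walk p hp)

/-! ### Rerouting paths between ancestral sets -/

/-- Every vertex of the ancestral closure of `K` outside `K` has a child in it. -/
theorem exists_child_mem_ancestralClosure {G : Digraph V} {K : Set V} {v : V}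
    (hv : v ∈ ancestralClosure G K) (hvK : v ∉ K) :
    ∃ w ∈ ancestralClosure G K, G.Adj v w := by
  by_contra! h
  have hsub : ancestralClosure G K ⊆ ancestralClosure G K \ {v} := by
    apply ancestralClosure_subset
    · intro x hx y hy
      refine ⟨isAncestral_ancestralClosure G K x hx.1 hy, ?_⟩
      rintro rfl
      exact h x hx.1 hy
    · intro x hx
      refine ⟨subset_ancestralClosure G K hx, ?_⟩
      rintro rfl
      exact hvK hx
  exact (hsub hv).2 rfl

/-- If the pairs of neighbours of `v` are adjacent after the removal of `v`, then `v` can be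
bypassed. -/
theorem Joined.bypass {G : Digraph V} {E E' C : Set V} {v : V}
    (hE : ∀ x y, x ≠ v → y ≠ v → MoralAdj G E x y → MoralAdj G E' x y)
    (hv : ∀ x y, MoralAdj G E x v → MoralAdj G E y v → x ≠ y → MoralAdj G E' x y)
    {a b : V} (ha : a ≠ v) (hb : b ≠ v) (h : Joined G E C a b) : Joined G E' C a b := by
  obtain ⟨haC, h⟩ := h
  refine ⟨haC, ?_⟩
  -- When the path stands at `v`, the induction remembers the neighbour from which `v` was entered.
  have key : (b ≠ v → Relation.ReflTransGen (fun x y => MoralAdj G E' x y ∧ y ∉ C) a b) ∧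
      (b = v → ∃ x, MoralAdj G E x v ∧
        Relation.ReflTransGen (fun x y => MoralAdj G E' x y ∧ y ∉ C) a x) := by
    clear hb
    induction h with
    | refl => exact ⟨fun _ => .refl, fun h => absurd h ha⟩
    | @tail x y _ hxy ih =>
      refine ⟨fun hy => ?_, ?_⟩
      · by_cases hx : x = v
        · obtain ⟨z, hz, haz⟩ := ih.2 hx
          subst hx
          by_cases hzy : z = y
          · exact hzy ▸ haz
          · exact haz.tail ⟨hv z y hz hxy.1.symm hzy, hxy.2⟩
        · exact (ih.1 hx).tail ⟨hE x y hx hy hxy.1, hxy.2⟩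
      · rintro rfl
        exact ⟨x, hxy.1, ih.1 hxy.1.1⟩
  exact key.1 hb

/-- Let `G` and `G'` have the same families, and let `v` be a sink of `G'` in `E`. If `v` has a
child in `G` in `E`, then it has one of which all its other neighbours in `E` are parents. -/
theorem exists_dominating_child [Finite V] {G G' : Digraph V} (hG : IsAcyclic G)
    (h : ∀ S, IsFamily G S ↔ IsFamily G' S) {E : Set V} {v : V}
    (hchild : ∃ w ∈ E, G.Adj v w) (hsink : ∀ w ∈ E, ¬ G'.Adj v w) :
    ∃ w ∈ E, G.Adj v w ∧ ∀ x, MoralAdj G E x v → x = w ∨ G.Adj x w := by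
  obtain ⟨r, hr, hrG⟩ := id hG
  obtain ⟨w, ⟨hwE, hvw⟩, hlast⟩ := exists_last hr (S := {w | w ∈ E ∧ G.Adj v w}) hchild
  have hpar : ∀ x, MoralAdj G E x v → G'.Adj x v := by
    intro x hx
    rw [moralAdj_congr h, moralAdj_iff] at hx
    obtain ⟨-, hxE, -, hx | hx | ⟨z, hz, -, hx⟩⟩ := hx
    · exact hx
    · exact absurd hx (hsink x hxE)
    · exact absurd hx (hsink z hz)
  refine ⟨w, hwE, hvw, fun x hx => or_iff_not_imp_left.2 fun hxw => ?_⟩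
  have hvE : v ∈ E := (moralAdj_iff.1 hx).2.2.1
  have hxE : x ∈ E := (moralAdj_iff.1 hx).2.1
  have hne : v ≠ w := fun h => hG.irrefl v (by rwa [← h] at hvw)
  have hwv : G'.Adj w v := hpar w (moralAdj_iff.2 ⟨hne.symm, hwE, hvE, Or.inr (Or.inl hvw)⟩)
  have hfam : IsFamily G' {x, v, w} := by
    refine ⟨v, by simp, ?_⟩
    rintro u (rfl | rfl | rfl) hu
    · exact hpar u hx
    · exact absurd rfl hu
    · exact hwv
  obtain ⟨s, hs, hsadj⟩ := (h _).2 hfam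
  -- The sink in `G` is not `x`, since `w` is the last child of `v`, nor `v`, since `v → w`; so it
  -- is `w`.
  rcases hs with rfl | rfl | rfl
  · have h1 := hsadj v (by simp) hx.1.symm
    have h2 := hsadj w (by simp) (Ne.symm hxw)
    exact absurd (hrG _ _ h2) (hlast s ⟨hxE, h1⟩)
  · exact absurd (hsadj w (by simp) hne.symm) (hG.asymm hvw)
  · exact hsadj x (by simp) hxw

/-- A path in the moral graph on `E` can be rerouted through `E ∩ F` when `F` is ancestral in an
equivalent graph and every vertex of `E \ K` has a child in `E`. -/
theorem Joined.inter [Finite V] {G G' : Digraph V} (hG : IsAcyclic G) (hG' : IsAcyclic G')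
    (h : ∀ S, IsFamily G S ↔ IsFamily G' S) {K F : Set V} (hF : IsAncestral G' F)
    (hKF : K ⊆ F) {C : Set V} {a b : V} (ha : a ∈ K) (hb : b ∈ K) (E : Set V)
    (hE : ∀ v ∈ E, v ∉ K → ∃ w ∈ E, G.Adj v w) (hab : Joined G E C a b) :
    Joined G (E ∩ F) C a b := by
  induction hn : (E \ F).ncard using Nat.strong_induction_on generalizing E with
  | _ n ih =>
    rcases (E \ F).eq_empty_or_nonempty with hEF | hEF
    · rwa [Set.inter_eq_left.2 (Set.sdiff_eq_empty.1 hEF)]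
    obtain ⟨r, hr, hrG⟩ := id hG'
    obtain ⟨v, ⟨hvE, hvF⟩, hlast⟩ := exists_last hr hEF
    have hvK : v ∉ K := fun hv => hvF (hKF hv)
    have hsink : ∀ w ∈ E, ¬ G'.Adj v w := fun w hw hvw =>
      hlast w ⟨hw, fun hwF => hvF (hF w hwF hvw)⟩ (hrG _ _ hvw)
    obtain ⟨w, hwE, hvw, hdom⟩ := exists_dominating_child hG h (hE v hvE hvK) hsink
    have hwv : w ≠ v := fun h => hG.irrefl v (by rwa [h] at hvw)
    have hnbr : ∀ x y, MoralAdj G E x v → MoralAdj G E y v → x ≠ y →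
        MoralAdj G (E \ {v}) x y := by
      intro x y hx hy hxy
      refine moralAdj_iff.2 ⟨hxy, ⟨(moralAdj_iff.1 hx).2.1, hx.1⟩,
        ⟨(moralAdj_iff.1 hy).2.1, hy.1⟩, ?_⟩
      rcases hdom x hx with rfl | hxw
      · rcases hdom y hy with rfl | hyw
        · exact absurd rfl hxy
        · exact Or.inr (Or.inl hyw)
      · rcases hdom y hy with rfl | hyw
        · exact Or.inl hxw
        · exact Or.inr (Or.inr ⟨w, ⟨hwE, hwv⟩, hxw, hyw⟩)
    have hab' : Joined G (E \ {v}) C a b := by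
      refine Joined.bypass ?_ hnbr (fun h => hvK (h ▸ ha)) (fun h => hvK (h ▸ hb)) hab
      intro x y hxv hyv hxy
      obtain ⟨hne, hxE, hyE, hx | hx | ⟨z, hzE, hxz, hyz⟩⟩ := moralAdj_iff.1 hxy
      · exact moralAdj_iff.2 ⟨hne, ⟨hxE, hxv⟩, ⟨hyE, hyv⟩, Or.inl hx⟩
      · exact moralAdj_iff.2 ⟨hne, ⟨hxE, hxv⟩, ⟨hyE, hyv⟩, Or.inr (Or.inl hx)⟩
      · by_cases hz : z = v
        · subst hz
          exact hnbr x y (moralAdj_iff.2 ⟨hxv, hxE, hvE, Or.inl hxz⟩)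
            (moralAdj_iff.2 ⟨hyv, hyE, hvE, Or.inl hyz⟩) hne
        · exact moralAdj_iff.2 ⟨hne, ⟨hxE, hxv⟩, ⟨hyE, hyv⟩,
            Or.inr (Or.inr ⟨z, ⟨hzE, hz⟩, hxz, hyz⟩)⟩
    -- Deleting `v` destroys ancestrality but keeps this condition: a vertex that loses its child
    -- `v` is a neighbour of `v`, hence a parent of `w`.
    have hchild : ∀ u ∈ E \ {v}, u ∉ K → ∃ z ∈ E \ {v}, G.Adj u z := by
      rintro u ⟨huE, huv⟩ huK
      obtain ⟨z, hzE, huz⟩ := hE u huE huK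
      by_cases hz : z = v
      · subst hz
        rcases hdom u (moralAdj_iff.2 ⟨huv, huE, hvE, Or.inl huz⟩) with rfl | huw
        · exact absurd huz (hG.asymm hvw)
        · exact ⟨w, ⟨hwE, hwv⟩, huw⟩
      · exact ⟨z, ⟨hzE, hz⟩, huz⟩
    have hlt : ((E \ {v}) \ F).ncard < n := by
      rw [← hn]
      refine Set.ncard_lt_ncard ⟨fun x hx => ⟨hx.1.1, hx.2⟩, fun hsub => ?_⟩
      exact (hsub ⟨hvE, hvF⟩).1.2 rfl
    exact (ih _ hlt (E \ {v}) hchild hab' rfl).mono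
      (Set.inter_subset_inter_left _ Set.sdiff_subset)

theorem semigraphoid_subset_of_isFamily_iff [Finite V] {G G' : Digraph V} (hG : IsAcyclic G)
    (hG' : IsAcyclic G') (h : ∀ S, IsFamily G S ↔ IsFamily G' S) :
    semigraphoid G' ⊆ semigraphoid G := by
  rintro ⟨A, B, C⟩ hT
  rw [mem_semigraphoid_iff] at hT ⊢
  intro a ha b hb hab
  refine hT a ha b hb ((joined_congr h).1 (Joined.mono Set.inter_subset_right
    (hab.inter hG hG' h (isAncestral_ancestralClosure G' _) (subset_ancestralClosure G' _)
      (Or.inl (Or.inl ha)) (Or.inl (Or.inr hb)) _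
      fun v hv hvK => exists_child_mem_ancestralClosure hv hvK)))

/-! ### Recovering families from the semi-graphoid -/

theorem isFamily_iff_semigraphoid [Finite V] {G : Digraph V} (hG : IsAcyclic G) {S : Set V} :
    IsFamily G S ↔ S.Nonempty ∧ ∀ a ∈ S, ∀ b ∈ S, a ≠ b → ∀ C, S \ {a, b} ⊆ C →
      a ∉ C → b ∉ C → ({a}, {b}, C) ∉ semigraphoid G := by
  constructor
  · intro hS
    refine ⟨hS.imp fun _ h => h.1, fun a ha b hb hab C hC haC hbC hmem => ?_⟩
    refine mem_semigraphoid_iff.1 hmem a rfl b rfl ⟨haC, .single ⟨⟨hab, S, ?_, ha, hb, hS⟩, hbC⟩⟩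
    refine Set.Subset.trans ?_ (subset_ancestralClosure G _)
    intro x hx
    by_cases hxa : x = a
    · exact Or.inl (Or.inl hxa)
    · by_cases hxb : x = b
      · exact Or.inl (Or.inr hxb)
      · exact Or.inr (hC ⟨hx, by simp [hxa, hxb]⟩)
  · rintro ⟨hne, h⟩
    obtain ⟨r, hr, hrG⟩ := id hG
    obtain ⟨v, hvS, hlast⟩ := exists_last hr hne
    refine ⟨v, hvS, fun u huS huv => ?_⟩
    by_contra hadj
    have hbefore : ∀ x ∈ S, x ≠ v → r x v := fun x hx hxv =>
      (trichotomous_of r x v).resolve_right (not_or.2 ⟨hxv, hlast x hx⟩)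
    have hirr : ¬ r v v := irrefl_of r v
    -- Condition on all predecessors of `v` except `u`. The ancestral set then has only `u` and `v`
    -- outside the conditioning set, and `v` has no child there to create a moral edge.
    refine h u huS v hvS huv ({x | r x v} \ {u}) ?_ (fun h => h.2 rfl) (fun h => hirr h.1) ?_
    · intro x hx
      simp only [Set.mem_sdiff, Set.mem_insert_iff, Set.mem_singleton_iff, not_or] at hx
      exact ⟨hbefore x hx.1 hx.2.2, hx.2.1⟩
    rw [mem_semigraphoid_iff]
    rintro a rfl b rfl hj
    have hsub : ancestralClosure G ({a} ∪ {b} ∪ {x | r x b} \ {a}) ⊆ {x | x = b ∨ r x b} := by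
      apply ancestralClosure_subset
      · rintro x (rfl | hx) y hy
        · exact Or.inr (hrG _ _ hy)
        · exact Or.inr (trans_of r (hrG _ _ hy) hx)
      · rintro x ((rfl | rfl) | hx)
        · exact Or.inr (hbefore x huS huv)
        · exact Or.inl rfl
        · exact Or.inr hx.1
    have hstay : ∀ x y, MoralAdj G (ancestralClosure G ({a} ∪ {b} ∪ {x | r x b} \ {a})) x y →
        y ∉ {x | r x b} \ {a} → x = a → y = a := by
      rintro x y hxy hy rfl
      by_contra hyx
      obtain ⟨-, -, hyE, hxy'⟩ := moralAdj_iff.1 hxy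
      have hyb : y = b := (hsub hyE).resolve_right fun hry => hy ⟨hry, hyx⟩
      subst hyb
      rcases hxy' with h1 | h1 | ⟨z, hz, -, h1⟩
      · exact hadj h1
      · exact irrefl_of r x (trans_of r (hbefore x huS huv) (hrG _ _ h1))
      · rcases hsub hz with rfl | hz
        · exact hG.irrefl z h1
        · exact irrefl_of r z (trans_of r hz (hrG _ _ h1))
    have hb : b = a := by
      have : ∀ c, Relation.ReflTransGen (fun x y =>
          MoralAdj G (ancestralClosure G ({a} ∪ {b} ∪ {x | r x b} \ {a})) x y ∧
            y ∉ {x | r x b} \ {a}) a c → c = a := by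
        intro c hc
        induction hc with
        | refl => rfl
        | tail _ hxy ih => exact hstay _ _ hxy.1 hxy.2 ih
      exact this b hj.2
    exact huv hb.symm

theorem markovEquiv_iff_isFamily_iff [Finite V] {G G' : Digraph V} (hG : IsAcyclic G)
    (hG' : IsAcyclic G') : MarkovEquiv G G' ↔ ∀ S, IsFamily G S ↔ IsFamily G' S := by
  constructor
  · intro h S
    rw [isFamily_iff_semigraphoid hG, isFamily_iff_semigraphoid hG',
      show semigraphoid G = semigraphoid G' from h]
  · intro h
    exact (semigraphoid_subset_of_isFamily_iff hG' hG fun S => (h S).symm).antisymm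
      (semigraphoid_subset_of_isFamily_iff hG hG' h)

/-! ### Superset sums of the d-clique vector -/

open Classical in
/-- The sum of the coordinates of `f` over all supersets of `S`. -/
noncomputable def upperSum [Fintype V] (f : Set V → ℤ) (S : Set V) : ℤ :=
  ∑ T : Set V, if S ⊆ T then f T else 0

theorem upperSum_injective [Fintype V] :
    Function.Injective (upperSum : (Set V → ℤ) → Set V → ℤ) := by
  classical
  intro f g hfg
  funext S
  induction hn : (Sᶜ).ncard using Nat.strong_induction_on generalizing S with
  | _ n ih =>
    have h := congrFun hfg S
    unfold upperSum at h
    rw [← Finset.add_sum_erase _ _ (Finset.mem_univ S),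
      ← Finset.add_sum_erase (a := S) _ _ (Finset.mem_univ S), if_pos subset_rfl,
      if_pos subset_rfl] at h
    -- Descending induction: the terms of strict supersets already agree.
    refine add_right_cancel (h.trans (congrArg (g S + ·) (Finset.sum_congr rfl ?_)))
    intro T hT
    split_ifs with hST
    · refine (ih _ ?_ T rfl).symm
      rw [← hn]
      exact Set.ncard_lt_ncard (compl_lt_compl_iff_lt.2
        (hST.ssubset_of_ne (Finset.ne_of_mem_erase hT).symm))
    · rfl

open Classical in
theorem upperSum_dCliqueVector [Fintype V] {G : Digraph V} (hG : IsAcyclic G) (S : Set V) :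
    upperSum (dCliqueVector G) S = if S = ∅ ∨ IsFamily G S then 1 else 0 := by
  have hdelta : ∀ A : Set V, upperSum (delta A) S = if S ⊆ A then 1 else 0 := by
    intro A
    unfold upperSum delta
    rw [Finset.sum_eq_single A (fun T _ hT => by simp [hT]) (by simp)]
    simp
  have hlin : upperSum (dCliqueVector G) S =
      ∑ v : V, (upperSum (delta ({v} ∪ parents G v)) S - upperSum (delta (parents G v)) S)
        + upperSum (delta ∅) S := by
    unfold upperSum dCliqueVector
    simp_rw [← Finset.sum_sub_distrib]
    rw [Finset.sum_comm, ← Finset.sum_add_distrib]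
    refine Finset.sum_congr rfl fun T _ => ?_
    split_ifs <;> simp [Finset.sum_apply]
  have hterm : ∀ v, upperSum (delta ({v} ∪ parents G v)) S - upperSum (delta (parents G v)) S =
      if v ∈ S ∧ ∀ u ∈ S, u ≠ v → G.Adj u v then 1 else 0 := by
    intro v
    rw [hdelta, hdelta]
    have h1 : S ⊆ {v} ∪ parents G v ↔ ∀ u ∈ S, u ≠ v → G.Adj u v := by
      refine forall₂_congr fun u _ => ?_
      exact or_iff_not_imp_left
    by_cases hv : v ∈ S
    · have h2 : ¬ S ⊆ parents G v := fun h => hG.irrefl v (h hv)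
      simp only [h1, h2, hv, if_false, sub_zero, true_and]
    · have h2 : S ⊆ {v} ∪ parents G v ↔ S ⊆ parents G v := by
        rw [h1]
        exact forall₂_congr fun u hu => ⟨fun h => h fun huv => hv (huv ▸ hu), fun h _ => h⟩
      simp only [h2, hv, sub_self, false_and, if_false]
  rw [hlin, hdelta, Finset.sum_congr rfl fun v _ => hterm v]
  by_cases hfam : IsFamily G S
  · obtain ⟨v, hv, hvS⟩ := id hfam
    have hS : ¬ S ⊆ ∅ := fun h => h hv
    rw [if_pos (Or.inr hfam), if_neg hS, Finset.sum_eq_single v, if_pos ⟨hv, hvS⟩, add_zero]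
    · intro u _ huv
      -- Two sinks of one family would be joined by edges in both directions.
      exact if_neg fun ⟨hu, huS⟩ => hG.asymm (hvS u hu huv) (huS v hv huv.symm)
    · simp
  · rw [Finset.sum_eq_zero fun v _ => if_neg fun hv => hfam ⟨v, hv⟩]
    simp [hfam, Set.subset_empty_iff]

theorem dCliqueVector_eq_iff_isFamily_iff [Fintype V] {G G' : Digraph V} (hG : IsAcyclic G)
    (hG' : IsAcyclic G') :
    dCliqueVector G = dCliqueVector G' ↔ ∀ S, IsFamily G S ↔ IsFamily G' S := by
  classical
  rw [← upperSum_injective.eq_iff, funext_iff]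
  refine forall_congr' fun S => ?_
  rw [upperSum_dCliqueVector hG, upperSum_dCliqueVector hG']
  rcases S.eq_empty_or_nonempty with rfl | hS
  · simp [IsFamily]
  · by_cases h : IsFamily G S <;> by_cases h' : IsFamily G' S <;> simp [h, h', hS.ne_empty]

end DagMarkov

theorem mainTheorem3 {V : Type*} [Fintype V] (G G' : Digraph V)
    (hG : DagMarkov.IsAcyclic G) (hG' : DagMarkov.IsAcyclic G') :
    DagMarkov.MarkovEquiv G G' ↔
      DagMarkov.dCliqueVector G = DagMarkov.dCliqueVector G' := by
  rw [DagMarkov.markovEquiv_iff_isFamily_iff hG hG',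
    DagMarkov.dCliqueVector_eq_iff_isFamily_iff hG hG']
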